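/- For real $k$ with $k^2<1$ let $F(\varphi,k)=\int_0^{\varphi}\frac{d\theta}{\sqrt{1-k^2\sin^2\theta}}$, let $\mathrm{am}(\cdot,k):\mathbb R\to\mathbb R$ be the inverse of the bijection $\varphi\mapsto F(\varphi,k)$, and let $\mathrm{sn}(u,k)=\sin(\mathrm{am}(u,k))$ be Jacobi's sinus amplitudinis. Let $\gamma,\delta,E$ be real with $\gamma>0$, put $Q(v)=\gamma v^4-\delta+2Ev^2$, and consider the first integral $v_t^2=Q(v)$. The quartic $Q$ has four distinct real roots $v_1>v_2>v_3>v_4$ if and only if $\delta<0$ and $E<-\sqrt{-\gamma\delta}$ (for $\gamma=-\delta=1$: if and only if $E<-1$). Assume that this is the case and put $$k=\sqrt{\frac{v_4-v_1}{v_4-v_2}\cdot\frac{v_2-v_3}{v_1-v_3}},\qquad Z(t)=\frac{v_4-v_1}{v_4-v_2}\,\mathrm{sn}^2\!\left(\frac{\sqrt{\gamma}\,\sqrt{(v_3-v_1)(v_4-v_2)}}{2}\,t,\;k\right),$$ $$D(t)=1-Z(t),\qquad V(t)=\frac{v_1-v_2\,Z(t)}{1-Z(t)}.$$ For $\gamma=-\delta=1$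 the argument of $\mathrm{sn}$ is $\sqrt{(v_3-v_1)(v_4-v_2)}\,t/2$. Then: 1. $k^2=\frac{v_4-v_1}{v_4-v_2}\cdot\frac{v_2-v_3}{v_1-v_3}$ and $0<k<1$. 2. $V(0)=v_1$, and at every real $t$ with $D(t)\neq 0$ the function $V$ is differentiable and $V'(t)^2=Q(V(t))$. 3. $V$ is the inversion of the elliptic integral based at $v_1$: for every $x\ge v_1$ the function $1/\sqrt{Q}$ is integrable on $[v_1,x]$, and for every $t\ge 0$ one has $\int_{v_1}^{x}\frac{ds}{\sqrt{Q(s)}}=t$ if and only if $D>0$ on $[0,t]$ and $x=V(t)$. 4. Let $a<b$ and let $v:(a,b)\to\mathbb R$ be differentiable with $v>v_1$ and $v_t^2=Q(v)$ on $(a,b)$. Then there is a real $t_0$ such that $D(t-t_0)\neq 0$ and $v(t)=V(t-t_0)$ for all $t\in(a,b)$. -/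

import Mathlib

noncomputable section

namespace Elliptic

/-- Legendre's incomplete elliptic integral of the first kind
`F(φ, k) = ∫₀^φ dθ / √(1 - k² sin² θ)`. -/
def legendreF (k φ : ℝ) : ℝ :=
  ∫ θ in (0 : ℝ)..φ, 1 / √(1 - k ^ 2 * Real.sin θ ^ 2)

/-- Jacobi's amplitude `am(u, k)`: the inverse function of `φ ↦ F(φ, k)`, which is a bijection
of `ℝ` when `k² < 1` (see `legendreF_bijective`). -/
def am (u k : ℝ) : ℝ :=
  Function.invFun (legendreF k) u

/-- Jacobi's sinus amplitudinis `sn(u, k) = sin (am(u, k))`. -/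
def sn (u k : ℝ) : ℝ :=
  Real.sin (am u k)

lemma radicand_pos {k : ℝ} (hk : k ^ 2 < 1) (θ : ℝ) :
    0 < 1 - k ^ 2 * Real.sin θ ^ 2 := by
  nlinarith [Real.sin_sq_le_one θ, sq_nonneg (Real.sin θ), sq_nonneg k]

lemma integrand_continuous {k : ℝ} (hk : k ^ 2 < 1) :
    Continuous fun θ : ℝ => 1 / √(1 - k ^ 2 * Real.sin θ ^ 2) := by
  refine Continuous.div continuous_const (by fun_prop) fun θ => ?_
  exact (Real.sqrt_pos.2 (radicand_pos hk θ)).ne'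

lemma one_le_integrand {k : ℝ} (hk : k ^ 2 < 1) (θ : ℝ) :
    1 ≤ 1 / √(1 - k ^ 2 * Real.sin θ ^ 2) := by
  rw [le_div_iff₀ (Real.sqrt_pos.2 (radicand_pos hk θ)), one_mul]
  exact Real.sqrt_le_one.2 (by nlinarith [mul_nonneg (sq_nonneg k) (sq_nonneg (Real.sin θ))])

lemma legendreF_hasDerivAt {k : ℝ} (hk : k ^ 2 < 1) (φ : ℝ) :
    HasDerivAt (legendreF k) (1 / √(1 - k ^ 2 * Real.sin φ ^ 2)) φ :=
  (integrand_continuous hk).integral_hasStrictDerivAt 0 φ |>.hasDerivAt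

lemma sub_le_legendreF_sub {k : ℝ} (hk : k ^ 2 < 1) {a b : ℝ} (hab : a ≤ b) :
    b - a ≤ legendreF k b - legendreF k a := by
  have hd : Differentiable ℝ (legendreF k) := fun x =>
    (legendreF_hasDerivAt hk x).differentiableAt
  have h := mul_sub_le_image_sub_of_le_deriv hd (C := 1)
    (fun x => by rw [(legendreF_hasDerivAt hk x).deriv]; exact one_le_integrand hk x) hab
  linarith

lemma legendreF_bijective {k : ℝ} (hk : k ^ 2 < 1) : Function.Bijective (legendreF k) := by
  have h0 : legendreF k 0 = 0 := by simp [legendreF]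
  have hmono : StrictMono (legendreF k) := fun a b hab => by
    have := sub_le_legendreF_sub hk hab.le
    linarith
  refine ⟨hmono.injective, Continuous.surjective ?_ ?_ ?_⟩
  · exact continuous_iff_continuousAt.2 fun x => (legendreF_hasDerivAt hk x).continuousAt
  · refine Filter.tendsto_atTop_mono' _ ?_ Filter.tendsto_id
    filter_upwards [Filter.eventually_ge_atTop (0 : ℝ)] with x hx
    have := sub_le_legendreF_sub hk hx
    simp only [id]
    linarith
  · refine Filter.tendsto_atBot_mono' _ ?_ Filter.tendsto_id
    filter_upwards [Filter.eventually_le_atBot (0 : ℝ)] with x hx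
    have := sub_le_legendreF_sub hk hx
    simp only [id]
    linarith

/-- The right-hand side `γ v⁴ - δ + 2 E v²` of the first integral. -/
def quartic (γ δ E v : ℝ) : ℝ :=
  γ * v ^ 4 - δ + 2 * E * v ^ 2

/-- `v₁ > v₂ > v₃ > v₄` are (all) the roots of the quartic. -/
structure IsOrderedRoots (γ δ E v₁ v₂ v₃ v₄ : ℝ) : Prop where
  lt₁₂ : v₂ < v₁
  lt₂₃ : v₃ < v₂
  lt₃₄ : v₄ < v₃
  root₁ : quartic γ δ E v₁ = 0
  root₂ : quartic γ δ E v₂ = 0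
  root₃ : quartic γ δ E v₃ = 0
  root₄ : quartic γ δ E v₄ = 0

/-- The expression for the squared modulus in terms of the roots. -/
def modulusSq (v₁ v₂ v₃ v₄ : ℝ) : ℝ :=
  (v₄ - v₁) / (v₄ - v₂) * ((v₂ - v₃) / (v₁ - v₃))

/-- The Jacobi modulus `k ≥ 0`. -/
def modulus (v₁ v₂ v₃ v₄ : ℝ) : ℝ :=
  √(modulusSq v₁ v₂ v₃ v₄)

/-- `(v₄ - v₁) / (v₄ - v₂) * sn² (√γ √((v₃ - v₁)(v₄ - v₂)) t / 2, k)`. -/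
def scaledSnSq (γ v₁ v₂ v₃ v₄ t : ℝ) : ℝ :=
  (v₄ - v₁) / (v₄ - v₂) *
    sn (√γ * √((v₃ - v₁) * (v₄ - v₂)) / 2 * t) (modulus v₁ v₂ v₃ v₄) ^ 2

/-- The denominator of the Möbius expression in `sn²`. -/
def den (γ v₁ v₂ v₃ v₄ t : ℝ) : ℝ :=
  1 - scaledSnSq γ v₁ v₂ v₃ v₄ t

/-- The Möbius expression in `sn²`. -/
def snSolution (γ v₁ v₂ v₃ v₄ t : ℝ) : ℝ :=
  (v₁ - v₂ * scaledSnSq γ v₁ v₂ v₃ v₄ t) / den γ v₁ v₂ v₃ v₄ t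

end Elliptic

end

namespace Elliptic

open Real Set

/-! Since `Q` is even, its roots are `±a, ±b` with `a > b > 0`, and `Q(v) = γ(v² - a²)(v² - b²)`.
The modulus becomes `k² = 4ab/(a+b)²` and the factor of `t` becomes `c = √γ(a+b)/2`. The
substitution `sin² φ = (a+b)/(2a) · (x-a)/(x-b)` turns `dx/√Q(x)` into `dφ/(c√(1 - k² sin² φ))`.
Hence `T(x) = F(φ(x), k)/c` is the primitive of `1/√Q` vanishing at `a` (`ellipticTime_hasDerivAt`).
Solving for `x` gives the Möbius expression `V` in `sn²`, so `V` and `T` are mutually inverse up to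
the first pole of `V` (`snSolution_ellipticTime`, `ellipticTime_snSolution`). For any solution `v >
a`, `T ∘ v` has slope `±1` with constant sign; as `V` is even, both signs give a translate of `V`.
-/

lemma quartic_eq_of_ordered_roots {γ δ E v₁ v₂ v₃ v₄ : ℝ} (hγ : 0 < γ)
    (h : IsOrderedRoots γ δ E v₁ v₂ v₃ v₄) :
    0 < v₂ ∧ v₂ < v₁ ∧ v₃ = -v₂ ∧ v₄ = -v₁ ∧ δ = -(γ * (v₁ ^ 2 * v₂ ^ 2)) ∧
      2 * E = -(γ * (v₁ ^ 2 + v₂ ^ 2)) := by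
  obtain ⟨h12, h23, h34, r1, r2, r3, r4⟩ := h
  have pair : ∀ x y : ℝ, y < x → quartic γ δ E x = 0 → quartic γ δ E y = 0 →
      x + y = 0 ∨ γ * (x ^ 2 + y ^ 2) + 2 * E = 0 := by
    intro x y hxy hx hy
    have h0 : (x - y) * ((x + y) * (γ * (x ^ 2 + y ^ 2) + 2 * E)) = 0 := by
      unfold quartic at hx hy
      linear_combination hx - hy
    rcases mul_eq_zero.1 h0 with h | h
    · linarith
    · exact mul_eq_zero.1 h
  -- Otherwise `x² + y²` and `x² + z²` both equal `-2E/γ`, which forces `y² = z²`.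
  have triple : ∀ x y z : ℝ, y < x → z < y → quartic γ δ E x = 0 → quartic γ δ E y = 0 →
      quartic γ δ E z = 0 → x + y = 0 ∨ x + z = 0 ∨ y + z = 0 := by
    intro x y z hxy hyz hx hy hz
    rcases pair x y hxy hx hy with h | h
    · exact Or.inl h
    rcases pair x z (hyz.trans hxy) hx hz with h' | h'
    · exact Or.inr (Or.inl h')
    have h0 : (y - z) * (y + z) = 0 := by
      apply (mul_eq_zero.1 (_ : γ * ((y - z) * (y + z)) = 0)).resolve_left hγ.ne'
      linear_combination h - h'
    rcases mul_eq_zero.1 h0 with h'' | h''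
    · linarith
    · exact Or.inr (Or.inr h'')
  -- The ordering excludes every pairing into opposites except the nested one.
  have sym : v₂ + v₃ = 0 ∧ v₁ + v₄ = 0 := by
    rcases triple _ _ _ h12 h23 r1 r2 r3 with h | h | h <;>
    rcases triple _ _ _ h23 h34 r2 r3 r4 with h' | h' | h' <;>
    rcases triple _ _ _ h12 (h34.trans h23) r1 r2 r4 with h'' | h'' | h'' <;>
    exact ⟨by linarith, by linarith⟩
  have hb : 0 < v₂ := by linarith [sym.1]
  have h2E : γ * (v₁ ^ 2 + v₂ ^ 2) + 2 * E = 0 :=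
    (pair _ _ h12 r1 r2).resolve_left (by linarith)
  refine ⟨hb, h12, by linarith [sym.1], by linarith [sym.2], ?_, by linarith⟩
  unfold quartic at r1
  linear_combination -r1 + v₁ ^ 2 * h2E

lemma exists_ordered_roots_iff {γ δ E : ℝ} (hγ : 0 < γ) :
    (∃ v₁ v₂ v₃ v₄ : ℝ, IsOrderedRoots γ δ E v₁ v₂ v₃ v₄) ↔ δ < 0 ∧ E < -√(γ * -δ) := by
  constructor
  · rintro ⟨a, b, _, _, h⟩
    obtain ⟨hb, hab, -, -, hδ, hE⟩ := quartic_eq_of_ordered_roots hγ h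
    have ha : 0 < a := hb.trans hab
    have hs : √(γ * -δ) = γ * (a * b) := by
      rw [hδ, show γ * -(-(γ * (a ^ 2 * b ^ 2))) = (γ * (a * b)) ^ 2 by ring]
      exact sqrt_sq (by positivity)
    refine ⟨by rw [hδ]; have : 0 < γ * (a ^ 2 * b ^ 2) := by positivity
               linarith, ?_⟩
    rw [hs]
    have : 0 < γ * (a - b) ^ 2 := mul_pos hγ (pow_pos (by linarith) 2)
    linarith [this, show γ * (a - b) ^ 2 = γ * (a ^ 2 + b ^ 2) - 2 * (γ * (a * b)) by ring]
  · rintro ⟨hδ, hE⟩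
    have hs : √(γ * -δ) ^ 2 = γ * -δ := sq_sqrt (by nlinarith)
    have hs0 := sqrt_nonneg (γ * -δ)
    have hdisc : 0 < E ^ 2 + γ * δ := by nlinarith
    set r := √(E ^ 2 + γ * δ) with hr
    have hr0 : 0 < r := sqrt_pos.2 hdisc
    have hr2 : r ^ 2 = E ^ 2 + γ * δ := sq_sqrt hdisc.le
    have hrE : r < -E := by
      apply lt_of_pow_lt_pow_left₀ 2 (by linarith)
      rw [hr2]
      nlinarith
    -- As a quadratic in `v²`, `Q` vanishes at `v² = (-E ± r)/γ`; `r < -E` makes both values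
    -- positive.
    have key : ∀ ε : ℝ, ε ^ 2 = r ^ 2 → 0 < -E + ε →
        0 < √((-E + ε) / γ) ∧ quartic γ δ E √((-E + ε) / γ) = 0 := by
      intro ε hε hpos
      have hp : 0 < (-E + ε) / γ := div_pos hpos hγ
      refine ⟨sqrt_pos.2 hp, ?_⟩
      have h4 : √((-E + ε) / γ) ^ 4 = ((-E + ε) / γ) ^ 2 := by
        rw [show (4 : ℕ) = 2 * 2 from rfl, pow_mul, sq_sqrt hp.le]
      rw [quartic, h4, sq_sqrt hp.le]
      field_simp
      linear_combination hε + hr2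
    have heven : ∀ v, quartic γ δ E (-v) = quartic γ δ E v := fun v => by unfold quartic; ring
    obtain ⟨p1, q1⟩ := key r rfl (by linarith)
    obtain ⟨p2, q2⟩ := key (-r) (by ring) (by linarith)
    have hlt : √((-E + -r) / γ) < √((-E + r) / γ) :=
      sqrt_lt_sqrt (div_pos (by linarith) hγ).le (div_lt_div_of_pos_right (by linarith) hγ)
    exact ⟨_, _, _, _, hlt, by linarith, neg_lt_neg hlt, q1, q2, by rw [heven, q2],
      by rw [heven, q1]⟩

/-! ### Parity and derivatives of `am` and `sn` -/

lemma legendreF_neg (k φ : ℝ) : legendreF k (-φ) = -legendreF k φ := by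
  unfold legendreF
  have := intervalIntegral.integral_comp_neg (a := 0) (b := φ)
    fun θ => 1 / √(1 - k ^ 2 * sin θ ^ 2)
  simp only [sin_neg, neg_sq, neg_zero] at this
  rw [intervalIntegral.integral_symm, ← this]

section Amplitude

variable {k : ℝ} (hk : k ^ 2 < 1)
include hk

lemma legendreF_strictMono : StrictMono (legendreF k) := fun a b hab => by
  have := sub_le_legendreF_sub hk hab.le
  linarith

lemma legendreF_am (u : ℝ) : legendreF k (am u k) = u :=
  Function.invFun_eq ((legendreF_bijective hk).2 u)

lemma am_legendreF (φ : ℝ) : am (legendreF k φ) k = φ :=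
  Function.leftInverse_invFun (legendreF_bijective hk).1 φ

lemma am_strictMono : StrictMono fun u => am u k := fun u v huv => by
  rw [← (legendreF_strictMono hk).lt_iff_lt, legendreF_am hk, legendreF_am hk]
  exact huv

lemma am_zero : am 0 k = 0 := by
  have h0 : legendreF k 0 = 0 := by simp [legendreF]
  rw [← h0, am_legendreF hk, h0]

lemma am_neg (u : ℝ) : am (-u) k = -am u k := by
  apply (legendreF_strictMono hk).injective
  rw [legendreF_am hk, legendreF_neg, legendreF_am hk]

lemma sn_neg (u : ℝ) : sn (-u) k = -sn u k := by
  rw [sn, am_neg hk, sin_neg, sn]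

lemma am_continuous : Continuous fun u => am u k :=
  (am_strictMono hk).monotone.continuous_of_surjective fun φ => ⟨_, am_legendreF hk φ⟩

lemma am_hasDerivAt (u : ℝ) : HasDerivAt (fun u => am u k) √(1 - k ^ 2 * sn u k ^ 2) u := by
  have h := HasDerivAt.of_local_left_inverse (g := fun u => am u k) (a := u)
    (am_continuous hk).continuousAt (legendreF_hasDerivAt hk (am u k))
    (one_div_ne_zero (sqrt_pos.2 (radicand_pos hk _)).ne')
    (Filter.Eventually.of_forall (legendreF_am hk))
  simpa [sn] using h

lemma sn_hasDerivAt (u : ℝ) :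
    HasDerivAt (fun u => sn u k) (cos (am u k) * √(1 - k ^ 2 * sn u k ^ 2)) u :=
  (am_hasDerivAt hk u).sin

end Amplitude

/-! ### The Möbius expression for roots `a > b > -b > -a` -/

section Roots

variable {γ a b : ℝ}

lemma modulusSq_symm (hb : 0 < b) (hab : b < a) :
    modulusSq a b (-b) (-a) = 4 * a * b / (a + b) ^ 2 := by
  have h1 : a + b ≠ 0 := by linarith
  have h2 : -a - b ≠ 0 := by linarith
  have h3 : a - -b ≠ 0 := by linarith
  unfold modulusSq
  field_simp
  ring

lemma modulus_symm_sq (hb : 0 < b) (hab : b < a) :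
    modulus a b (-b) (-a) ^ 2 = 4 * a * b / (a + b) ^ 2 := by
  have ha : 0 < a := hb.trans hab
  rw [modulus, modulusSq_symm hb hab, sq_sqrt (by positivity)]

lemma modulus_symm_sq_lt_one (hb : 0 < b) (hab : b < a) : modulus a b (-b) (-a) ^ 2 < 1 := by
  rw [modulus_symm_sq hb hab, div_lt_one (pow_pos (by linarith) 2)]
  nlinarith [pow_pos (sub_pos.2 hab) 2]

lemma modulus_symm_pos (hb : 0 < b) (hab : b < a) : 0 < modulus a b (-b) (-a) := by
  have ha : 0 < a := hb.trans hab
  rw [modulus, modulusSq_symm hb hab]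
  positivity

/-- The factor of `t` in the argument of `sn`, for roots `a > b > -b > -a`. -/
noncomputable def frequency (γ a b : ℝ) : ℝ :=
  √γ * (a + b) / 2

lemma frequency_pos (hγ : 0 < γ) (hb : 0 < b) (hab : b < a) : 0 < frequency γ a b := by
  have : 0 < a + b := by linarith
  unfold frequency
  positivity

lemma scaledSnSq_symm (hb : 0 < b) (hab : b < a) (t : ℝ) :
    scaledSnSq γ a b (-b) (-a) t =
      2 * a / (a + b) * sn (frequency γ a b * t) (modulus a b (-b) (-a)) ^ 2 := by
  have h1 : a + b ≠ 0 := by linarith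
  have h2 : -a - b ≠ 0 := by linarith
  have h3 : √((-b - a) * (-a - b)) = a + b := by
    rw [show (-b - a) * (-a - b) = (a + b) ^ 2 by ring]
    exact sqrt_sq (by linarith)
  rw [scaledSnSq, h3, frequency]
  congr 1
  field_simp
  ring

lemma scaledSnSq_neg (hb : 0 < b) (hab : b < a) (t : ℝ) :
    scaledSnSq γ a b (-b) (-a) (-t) = scaledSnSq γ a b (-b) (-a) t := by
  rw [scaledSnSq_symm hb hab, scaledSnSq_symm hb hab, mul_neg,
    sn_neg (modulus_symm_sq_lt_one hb hab), neg_sq]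

lemma den_neg (hb : 0 < b) (hab : b < a) (t : ℝ) :
    den γ a b (-b) (-a) (-t) = den γ a b (-b) (-a) t := by
  rw [den, scaledSnSq_neg hb hab, den]

lemma snSolution_neg (hb : 0 < b) (hab : b < a) (t : ℝ) :
    snSolution γ a b (-b) (-a) (-t) = snSolution γ a b (-b) (-a) t := by
  rw [snSolution, scaledSnSq_neg hb hab, den_neg hb hab, snSolution]

lemma snSolution_zero (hb : 0 < b) (hab : b < a) : snSolution γ a b (-b) (-a) 0 = a := by
  have h : scaledSnSq γ a b (-b) (-a) 0 = 0 := by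
    rw [scaledSnSq_symm hb hab, mul_zero, sn, am_zero (modulus_symm_sq_lt_one hb hab)]
    simp
  simp [snSolution, den, h]

/-- The squared derivative contains `sn`, `cos am` and the radical only to even powers, so it is
rational in `Z`, and the claim is an identity of rational functions. No sign or branch choice
enters, hence it holds beyond the poles too. -/
lemma snSolution_hasDerivAt (hγ : 0 < γ) (hb : 0 < b) (hab : b < a) {t : ℝ}
    (ht : den γ a b (-b) (-a) t ≠ 0) :
    ∃ d, HasDerivAt (snSolution γ a b (-b) (-a)) d t ∧
      d ^ 2 = γ * (snSolution γ a b (-b) (-a) t ^ 2 - a ^ 2) *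
        (snSolution γ a b (-b) (-a) t ^ 2 - b ^ 2) := by
  have ha : a ≠ 0 := by linarith
  have hk := modulus_symm_sq_lt_one hb hab
  have hk2 := modulus_symm_sq hb hab
  have hab0 : a + b ≠ 0 := by linarith
  set k := modulus a b (-b) (-a)
  set c := frequency γ a b with hc
  set Z := scaledSnSq γ a b (-b) (-a) with hZ
  have hZt : ∀ t, Z t = 2 * a / (a + b) * sn (c * t) k ^ 2 := scaledSnSq_symm hb hab
  set p := cos (am (c * t) k) with hp
  set q := √(1 - k ^ 2 * sn (c * t) k ^ 2) with hq
  set s := sn (c * t) k with hs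
  have hZd : HasDerivAt Z (2 * a / (a + b) * (2 * s * (p * q * c))) t := by
    have h1 : HasDerivAt (fun t => sn (c * t) k) (p * q * c) t := by
      have := (sn_hasDerivAt hk (c * t)).comp t ((hasDerivAt_id t).const_mul c)
      simpa [Function.comp_def] using this
    have h2 := (h1.pow 2).const_mul (2 * a / (a + b))
    rw [show Z = fun t => 2 * a / (a + b) * sn (c * t) k ^ 2 from funext hZt]
    refine h2.congr_deriv ?_
    norm_num
    exact Or.inl (Or.inl rfl)
  have hden : den γ a b (-b) (-a) t = 1 - Z t := rfl
  rw [hden] at ht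
  have hV : HasDerivAt (snSolution γ a b (-b) (-a)) _ t :=
    ((hZd.const_mul b).const_sub a).div (hZd.const_sub 1) ht
  refine ⟨_, hV, ?_⟩
  have hVt : snSolution γ a b (-b) (-a) t = (a - b * Z t) / (1 - Z t) := rfl
  have hq2 : q ^ 2 = 1 - k ^ 2 * s ^ 2 := sq_sqrt (radicand_pos hk _).le
  have hp2 : p ^ 2 = 1 - s ^ 2 := by rw [hp, cos_sq']; rfl
  have hc2 : c ^ 2 = γ * (a + b) ^ 2 / 4 := by
    rw [hc, frequency, div_pow, mul_pow, sq_sqrt hγ.le]; norm_num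
  set d := 2 * a / (a + b) * (2 * s * (p * q * c)) with hd
  have hd2 : d ^ 2 = 4 * (2 * a / (a + b)) ^ 2 * s ^ 2 * (1 - s ^ 2) *
      (1 - 4 * a * b / (a + b) ^ 2 * s ^ 2) * (γ * (a + b) ^ 2 / 4) := by
    rw [← hk2, ← hp2, ← hq2, ← hc2, hd]; ring
  have hnum : (-(b * d) * (1 - Z t) - (a - b * Z t) * -d) / (1 - Z t) ^ 2 =
      d * ((a - b) / (1 - Z t) ^ 2) := by ring
  rw [hden, hnum, mul_pow, hd2, hVt]
  have hs2 : s ^ 2 = (a + b) / (2 * a) * Z t := by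
    rw [hZt t, ← hs]; field_simp
  rw [hs2]
  generalize Z t = z at ht ⊢
  field_simp
  ring

/-! ### The elliptic integral and its inversion -/

/-- The amplitude at which the solution reaches the height `x ≥ a`. -/
noncomputable def heightAmplitude (a b x : ℝ) : ℝ :=
  arcsin √((a + b) / (2 * a) * ((x - a) / (x - b)))

/-- The time at which the solution reaches the height `x ≥ a`: a primitive of `1 / √Q`. -/
noncomputable def ellipticTime (γ a b x : ℝ) : ℝ :=
  legendreF (modulus a b (-b) (-a)) (heightAmplitude a b x) / frequency γ a b

lemma height_ratio_mem (hb : 0 < b) (hab : b < a) {x : ℝ} (hx : a ≤ x) :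
    0 ≤ (a + b) / (2 * a) * ((x - a) / (x - b)) ∧
      (a + b) / (2 * a) * ((x - a) / (x - b)) < 1 := by
  have ha : 0 < a := hb.trans hab
  have hxb : 0 < x - b := by linarith
  refine ⟨mul_nonneg (by positivity) (div_nonneg (by linarith) hxb.le), ?_⟩
  rw [div_mul_div_comm, div_lt_one (by positivity)]
  -- `2a(x-b) - (a+b)(x-a) = (a-b)(x+a)`.
  nlinarith [mul_pos (sub_pos.2 hab) (show 0 < x + a by linarith)]

lemma sin_heightAmplitude (hb : 0 < b) (hab : b < a) {x : ℝ} (hx : a ≤ x) :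
    sin (heightAmplitude a b x) = √((a + b) / (2 * a) * ((x - a) / (x - b))) :=
  sin_arcsin (by linarith [sqrt_nonneg ((a + b) / (2 * a) * ((x - a) / (x - b)))])
    (sqrt_le_one.2 (height_ratio_mem hb hab hx).2.le)

lemma heightAmplitude_mem (hb : 0 < b) (hab : b < a) {x : ℝ} (hx : a ≤ x) :
    heightAmplitude a b x ∈ Ico 0 (π / 2) := by
  refine ⟨arcsin_nonneg.2 (sqrt_nonneg _), arcsin_lt_pi_div_two.2 ?_⟩
  rw [sqrt_lt' one_pos, one_pow]
  exact (height_ratio_mem hb hab hx).2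

lemma am_ellipticTime (hγ : 0 < γ) (hb : 0 < b) (hab : b < a) (x : ℝ) :
    am (frequency γ a b * ellipticTime γ a b x) (modulus a b (-b) (-a)) =
      heightAmplitude a b x := by
  rw [ellipticTime, mul_div_cancel₀ _ (frequency_pos hγ hb hab).ne',
    am_legendreF (modulus_symm_sq_lt_one hb hab)]

lemma scaledSnSq_ellipticTime (hγ : 0 < γ) (hb : 0 < b) (hab : b < a) {x : ℝ} (hx : a ≤ x) :
    scaledSnSq γ a b (-b) (-a) (ellipticTime γ a b x) = (x - a) / (x - b) := by
  have ha : a ≠ 0 := by linarith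
  have hs : a + b ≠ 0 := by linarith
  rw [scaledSnSq_symm hb hab, sn, am_ellipticTime hγ hb hab, sin_heightAmplitude hb hab hx,
    sq_sqrt (height_ratio_mem hb hab hx).1]
  field_simp

lemma den_ellipticTime (hγ : 0 < γ) (hb : 0 < b) (hab : b < a) {x : ℝ} (hx : a ≤ x) :
    0 < den γ a b (-b) (-a) (ellipticTime γ a b x) := by
  rw [den, scaledSnSq_ellipticTime hγ hb hab hx, sub_pos, div_lt_one (by linarith)]
  linarith

lemma snSolution_ellipticTime (hγ : 0 < γ) (hb : 0 < b) (hab : b < a) {x : ℝ} (hx : a ≤ x) :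
    snSolution γ a b (-b) (-a) (ellipticTime γ a b x) = x := by
  have hd := den_ellipticTime hγ hb hab hx
  rw [snSolution, div_eq_iff hd.ne']
  rw [den, scaledSnSq_ellipticTime hγ hb hab hx]
  have : x - b ≠ 0 := by linarith
  field_simp
  ring

lemma ellipticTime_root : ellipticTime γ a b a = 0 := by
  simp [ellipticTime, heightAmplitude, legendreF]

lemma ellipticTime_continuousOn (hb : 0 < b) (hab : b < a) :
    ContinuousOn (ellipticTime γ a b) (Ici a) := by
  have hF : Continuous (legendreF (modulus a b (-b) (-a))) :=
    continuous_iff_continuousAt.2 fun φ =>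
      (legendreF_hasDerivAt (modulus_symm_sq_lt_one hb hab) φ).continuousAt
  have hr : ContinuousOn (fun x => √((a + b) / (2 * a) * ((x - a) / (x - b)))) (Ici a) :=
    (continuousOn_const.mul ((by fun_prop : ContinuousOn (fun x => x - a) (Ici a)).div
      (by fun_prop) fun x hx => by have : a ≤ x := hx
                                   linarith)).sqrt
  exact (hF.comp_continuousOn (continuous_arcsin.comp_continuousOn hr)).div_const _

lemma ellipticTime_hasDerivAt (hγ : 0 < γ) (hb : 0 < b) (hab : b < a) {x : ℝ} (hx : a < x) :
    HasDerivAt (ellipticTime γ a b) (1 / √(γ * (x ^ 2 - a ^ 2) * (x ^ 2 - b ^ 2))) x := by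
  have ha : 0 < a := hb.trans hab
  have hxb : 0 < x - b := by linarith
  have hxa : 0 < x - a := by linarith
  have hba : 0 < a - b := by linarith
  have hk := modulus_symm_sq_lt_one hb hab
  have hk2 := modulus_symm_sq hb hab
  have hc := frequency_pos hγ hb hab
  have hc2 : frequency γ a b ^ 2 = γ * (a + b) ^ 2 / 4 := by
    rw [frequency, div_pow, mul_pow, sq_sqrt hγ.le]; norm_num
  have hm := height_ratio_mem hb hab hx.le
  have hsin := sin_heightAmplitude hb hab hx.le
  have hr0 : 0 < (a + b) / (2 * a) * ((x - a) / (x - b)) := by positivity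
  have hr : HasDerivAt (fun x => (a + b) / (2 * a) * ((x - a) / (x - b)))
      ((a + b) / (2 * a) * ((1 * (x - b) - (x - a) * 1) / (x - b) ^ 2)) x :=
    (((hasDerivAt_id x).sub_const a).div ((hasDerivAt_id x).sub_const b) hxb.ne').const_mul _
  have hw := hr.sqrt hr0.ne'
  set w := √((a + b) / (2 * a) * ((x - a) / (x - b))) with hwdef
  have hw0 : 0 < w := sqrt_pos.2 hr0
  have hw2 : w ^ 2 = (a + b) / (2 * a) * ((x - a) / (x - b)) := sq_sqrt hr0.le
  have hw1 : w < 1 := by rw [hwdef, sqrt_lt' one_pos, one_pow]; exact hm.2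
  have hφ := (hasDerivAt_arcsin (by linarith) hw1.ne).comp x hw
  have hτ := ((legendreF_hasDerivAt hk (heightAmplitude a b x)).comp x hφ).div_const
    (frequency γ a b)
  rw [hsin] at hτ
  refine HasDerivAt.congr_deriv (f := ellipticTime γ a b) hτ ?_
  have e1 : 1 - w ^ 2 = (a - b) * (x + a) / (2 * a * (x - b)) := by
    rw [hw2]; field_simp; ring
  have e2 : 1 - modulus a b (-b) (-a) ^ 2 * w ^ 2 =
      (a - b) * (x + b) / ((a + b) * (x - b)) := by
    rw [hw2, hk2]; field_simp; ring
  have p1 : 0 < (a - b) * (x + a) / (2 * a * (x - b)) := by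
    have : 0 < x + a := by linarith
    positivity
  have p2 : 0 < (a - b) * (x + b) / ((a + b) * (x - b)) := by
    have : 0 < x + b := by linarith
    positivity
  have hQ : 0 < γ * (x ^ 2 - a ^ 2) * (x ^ 2 - b ^ 2) :=
    mul_pos (mul_pos hγ (by nlinarith)) (by nlinarith)
  rw [e1, e2, show 1 * (x - b) - (x - a) * 1 = a - b by ring]
  -- Both sides are nonnegative, so comparing squares removes all the radicals.
  apply (pow_left_inj₀ (by positivity) (by positivity) two_ne_zero).1
  simp only [mul_pow, div_pow, one_pow, sq_sqrt hQ.le, sq_sqrt p1.le, sq_sqrt p2.le, hc2, hw2]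
  have hxa' : x ^ 2 - a ^ 2 = (x - a) * (x + a) := by ring
  have hxb' : x ^ 2 - b ^ 2 = (x - b) * (x + b) := by ring
  rw [hxa', hxb']
  have n1 : x + a ≠ 0 := by linarith
  have n2 : x + b ≠ 0 := by linarith
  field_simp
  ring

/-- The integrand blows up at `a`, but it is the nonnegative derivative of a function continuous up
to `a`. -/
lemma intervalIntegrable_one_div_sqrt (hγ : 0 < γ) (hb : 0 < b) (hab : b < a) {x : ℝ}
    (hx : a ≤ x) :
    IntervalIntegrable (fun s => 1 / √(γ * (s ^ 2 - a ^ 2) * (s ^ 2 - b ^ 2)))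
      MeasureTheory.volume a x := by
  rw [intervalIntegrable_iff_integrableOn_Ioc_of_le hx]
  refine intervalIntegral.integrableOn_deriv_of_nonneg
    ((ellipticTime_continuousOn (γ := γ) hb hab).mono Icc_subset_Ici_self)
    (fun s hs => ellipticTime_hasDerivAt hγ hb hab hs.1) fun s _ => by positivity

lemma integral_one_div_sqrt (hγ : 0 < γ) (hb : 0 < b) (hab : b < a) {x : ℝ} (hx : a ≤ x) :
    ∫ s in a..x, 1 / √(γ * (s ^ 2 - a ^ 2) * (s ^ 2 - b ^ 2)) = ellipticTime γ a b x := by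
  rw [intervalIntegral.integral_eq_sub_of_hasDerivAt_of_le hx
    ((ellipticTime_continuousOn hb hab).mono Icc_subset_Ici_self)
    (fun s hs => ellipticTime_hasDerivAt hγ hb hab hs.1)
    (intervalIntegrable_one_div_sqrt hγ hb hab hx), ellipticTime_root, sub_zero]

/-- Up to time `T(x)` the amplitude stays in `[0, π/2)`, where `sin` increases, so `D` is at least
its value at `T(x)`. -/
lemma den_pos_of_le_ellipticTime (hγ : 0 < γ) (hb : 0 < b) (hab : b < a) {x t : ℝ}
    (hx : a ≤ x) (ht : 0 ≤ t) (htx : t ≤ ellipticTime γ a b x) :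
    0 < den γ a b (-b) (-a) t := by
  have hk := modulus_symm_sq_lt_one hb hab
  have hc := frequency_pos hγ hb hab
  refine (den_ellipticTime hγ hb hab hx).trans_le ?_
  have hφ := heightAmplitude_mem hb hab hx
  have h0 : 0 ≤ am (frequency γ a b * t) (modulus a b (-b) (-a)) := by
    have := (am_strictMono hk).monotone (mul_nonneg hc.le ht)
    simpa only [am_zero hk] using this
  have h1 : am (frequency γ a b * t) (modulus a b (-b) (-a)) ≤ heightAmplitude a b x := by
    rw [← am_ellipticTime hγ hb hab]
    exact (am_strictMono hk).monotone (mul_le_mul_of_nonneg_left htx hc.le)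
  rw [den, den, scaledSnSq_symm hb hab, scaledSnSq_symm hb hab, sn, sn,
    am_ellipticTime hγ hb hab]
  have hsin := sin_le_sin_of_le_of_le_pi_div_two (by linarith [pi_pos]) hφ.2.le h1
  have hs0 := sin_nonneg_of_nonneg_of_le_pi h0 (by linarith [pi_pos, hφ.2])
  have hA : 0 ≤ 2 * a / (a + b) := div_nonneg (by linarith) (by linarith)
  gcongr

lemma ellipticTime_snSolution (hγ : 0 < γ) (hb : 0 < b) (hab : b < a) {t : ℝ}
    (ht : 0 ≤ t) (hden : ∀ s ∈ Icc 0 t, 0 < den γ a b (-b) (-a) s) :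
    ellipticTime γ a b (snSolution γ a b (-b) (-a) t) = t := by
  have ha : 0 < a := hb.trans hab
  have hk := modulus_symm_sq_lt_one hb hab
  have hc := frequency_pos hγ hb hab
  have h0 : 0 ≤ am (frequency γ a b * t) (modulus a b (-b) (-a)) := by
    have := (am_strictMono hk).monotone (mul_nonneg hc.le ht)
    simpa only [am_zero hk] using this
  -- At amplitude `π/2`, `D = 1 - 2a/(a+b) < 0`, so positivity on all of `[0, t]` confines the
  -- amplitude to the branch that `arcsin` inverts.
  have hlt : am (frequency γ a b * t) (modulus a b (-b) (-a)) < π / 2 := by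
    by_contra! hge
    have hcont : Continuous fun s => am (frequency γ a b * s) (modulus a b (-b) (-a)) :=
      (am_continuous hk).comp (continuous_const.mul continuous_id)
    obtain ⟨s, hs, hsv⟩ := intermediate_value_Icc ht hcont.continuousOn
      (show π / 2 ∈ Icc _ _ from ⟨by simp only [mul_zero, am_zero hk]; positivity, hge⟩)
    have h := hden s hs
    dsimp only at hsv
    rw [den, scaledSnSq_symm hb hab, sn, hsv, sin_pi_div_two, one_pow, mul_one, sub_pos,
      div_lt_one (by linarith)] at h
    linarith
  have hd : 0 < den γ a b (-b) (-a) t := hden t ⟨ht, le_rfl⟩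
  have hz : (snSolution γ a b (-b) (-a) t - a) / (snSolution γ a b (-b) (-a) t - b) =
      scaledSnSq γ a b (-b) (-a) t := by
    have hne : (a - b) ≠ 0 := by linarith
    have hd' : 1 - scaledSnSq γ a b (-b) (-a) t ≠ 0 := hd.ne'
    have e1 : snSolution γ a b (-b) (-a) t - b =
        (a - b) / (1 - scaledSnSq γ a b (-b) (-a) t) := by
      rw [snSolution, den]; field_simp; ring
    have e2 : snSolution γ a b (-b) (-a) t - a =
        (a - b) * scaledSnSq γ a b (-b) (-a) t / (1 - scaledSnSq γ a b (-b) (-a) t) := by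
      rw [snSolution, den]; field_simp; ring
    rw [e1, e2]
    field_simp
  have hA : (a + b) / (2 * a) * scaledSnSq γ a b (-b) (-a) t =
      sin (am (frequency γ a b * t) (modulus a b (-b) (-a))) ^ 2 := by
    have : a + b ≠ 0 := by linarith
    rw [scaledSnSq_symm hb hab, sn]
    field_simp
  rw [ellipticTime, heightAmplitude, hz, hA,
    sqrt_sq (sin_nonneg_of_nonneg_of_le_pi h0 (by linarith [pi_pos])),
    arcsin_sin (by linarith [pi_pos]) hlt.le, legendreF_am hk, mul_div_cancel_left₀ _ hc.ne']

lemma exists_translate_of_first_integral (hγ : 0 < γ) (hb : 0 < b) (hab : b < a) {l r : ℝ}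
    {v v' : ℝ → ℝ} (hlr : l < r)
    (hv : ∀ t ∈ Ioo l r, a < v t ∧ HasDerivAt v (v' t) t ∧
      v' t ^ 2 = γ * (v t ^ 2 - a ^ 2) * (v t ^ 2 - b ^ 2)) :
    ∃ t₀ : ℝ, ∀ t ∈ Ioo l r, den γ a b (-b) (-a) (t - t₀) ≠ 0 ∧
      v t = snSolution γ a b (-b) (-a) (t - t₀) := by
  have ha : 0 < a := hb.trans hab
  have hne : ∀ t ∈ Ioo l r, v' t ≠ 0 := by
    intro t ht h0
    obtain ⟨h1, -, h3⟩ := hv t ht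
    have : 0 < γ * (v t ^ 2 - a ^ 2) * (v t ^ 2 - b ^ 2) :=
      mul_pos (mul_pos hγ (by nlinarith)) (by nlinarith)
    rw [← h3, h0] at this
    norm_num at this
  have hτ : ∀ t ∈ Ioo l r, HasDerivAt (fun t => ellipticTime γ a b (v t))
      (1 / |v' t| * v' t) t := by
    intro t ht
    obtain ⟨h1, h2, h3⟩ := hv t ht
    have := (ellipticTime_hasDerivAt hγ hb hab h1).comp t h2
    rwa [← h3, sqrt_sq_eq_abs] at this
  -- By Darboux, a nowhere zero derivative keeps its sign; continuity of `v'` is not needed.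
  have hsign : ∃ σ : ℝ, (σ = 1 ∨ σ = -1) ∧ ∀ t ∈ Ioo l r, 1 / |v' t| * v' t = σ := by
    rcases hasDerivWithinAt_forall_lt_or_forall_gt_of_forall_ne (convex_Ioo l r)
      (fun t ht => (hv t ht).2.1.hasDerivWithinAt) hne with h | h
    · refine ⟨-1, Or.inr rfl, fun t ht => ?_⟩
      rw [abs_of_neg (h t ht)]
      have := hne t ht
      field_simp
    · refine ⟨1, Or.inl rfl, fun t ht => ?_⟩
      rw [abs_of_pos (h t ht)]
      have := hne t ht
      field_simp
  obtain ⟨σ, hσ, hσv⟩ := hsign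
  obtain ⟨m, hm⟩ : (Ioo l r).Nonempty := nonempty_Ioo.2 hlr
  have hlin : ∀ t ∈ Ioo l r,
      ellipticTime γ a b (v t) - σ * t = ellipticTime γ a b (v m) - σ * m := by
    intro t ht
    have hd : ∀ s ∈ Ioo l r, HasDerivAt (fun t => ellipticTime γ a b (v t) - σ * t) 0 s := by
      intro s hs
      have := (hτ s hs).sub ((hasDerivAt_id s).const_mul σ)
      rw [hσv s hs, mul_one, sub_self] at this
      exact this
    exact isOpen_Ioo.is_const_of_deriv_eq_zero isPreconnected_Ioo
      (fun s hs => (hd s hs).differentiableAt.differentiableWithinAt)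
      (fun s hs => (hd s hs).deriv) ht hm
  have hsol : ∀ t ∈ Ioo l r, den γ a b (-b) (-a) (ellipticTime γ a b (v t)) ≠ 0 ∧
      v t = snSolution γ a b (-b) (-a) (ellipticTime γ a b (v t)) := fun t ht =>
    ⟨(den_ellipticTime hγ hb hab (hv t ht).1.le).ne',
      (snSolution_ellipticTime hγ hb hab (hv t ht).1.le).symm⟩
  -- As `σ² = 1`, this is the `t₀` for which `T(v(t)) = σ(t - t₀)`.
  refine ⟨m - σ * ellipticTime γ a b (v m), fun t ht => ?_⟩
  have h1 := hlin t ht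
  have h2 := hsol t ht
  rcases hσ with rfl | rfl
  · rwa [show ellipticTime γ a b (v t) = t - (m - 1 * ellipticTime γ a b (v m)) by linarith]
      at h2
  · rwa [show ellipticTime γ a b (v t) = -(t - (m - -1 * ellipticTime γ a b (v m))) by linarith,
      den_neg hb hab, snSolution_neg hb hab] at h2

end Roots

end Elliptic

theorem mainTheorem10 (γ δ E : ℝ) (hγ : 0 < γ) :
    -- when the quartic has four distinct real roots
    ((∃ v₁ v₂ v₃ v₄ : ℝ, Elliptic.IsOrderedRoots γ δ E v₁ v₂ v₃ v₄) ↔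
      δ < 0 ∧ E < -√(γ * -δ)) ∧
    ∀ v₁ v₂ v₃ v₄ : ℝ, Elliptic.IsOrderedRoots γ δ E v₁ v₂ v₃ v₄ →
      -- the modulus
      (Elliptic.modulus v₁ v₂ v₃ v₄ ^ 2 =
          (v₄ - v₁) / (v₄ - v₂) * ((v₂ - v₃) / (v₁ - v₃)) ∧
        0 < Elliptic.modulus v₁ v₂ v₃ v₄ ∧ Elliptic.modulus v₁ v₂ v₃ v₄ < 1) ∧
      -- the expression solves the first integral wherever its denominator does not vanish
      Elliptic.snSolution γ v₁ v₂ v₃ v₄ 0 = v₁ ∧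
      (∀ t : ℝ, Elliptic.den γ v₁ v₂ v₃ v₄ t ≠ 0 →
        ∃ d : ℝ, HasDerivAt (Elliptic.snSolution γ v₁ v₂ v₃ v₄) d t ∧
          d ^ 2 = Elliptic.quartic γ δ E (Elliptic.snSolution γ v₁ v₂ v₃ v₄ t)) ∧
      -- it inverts the elliptic integral based at the largest root
      (∀ x : ℝ, v₁ ≤ x →
        IntervalIntegrable (fun s : ℝ => 1 / √(Elliptic.quartic γ δ E s))
          MeasureTheory.volume v₁ x ∧
        ∀ t : ℝ, 0 ≤ t →
          ((∫ s in v₁..x, 1 / √(Elliptic.quartic γ δ E s)) = t ↔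
            (∀ τ ∈ Set.Icc 0 t, 0 < Elliptic.den γ v₁ v₂ v₃ v₄ τ) ∧
              x = Elliptic.snSolution γ v₁ v₂ v₃ v₄ t)) ∧
      -- every solution above the largest root is a time translate of it
      (∀ (a b : ℝ) (v v' : ℝ → ℝ), a < b →
        (∀ t ∈ Set.Ioo a b, v₁ < v t ∧ HasDerivAt v (v' t) t ∧
          v' t ^ 2 = Elliptic.quartic γ δ E (v t)) →
        ∃ t₀ : ℝ, ∀ t ∈ Set.Ioo a b,
          Elliptic.den γ v₁ v₂ v₃ v₄ (t - t₀) ≠ 0 ∧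
            v t = Elliptic.snSolution γ v₁ v₂ v₃ v₄ (t - t₀)) := by
  refine ⟨Elliptic.exists_ordered_roots_iff hγ, fun a b v₃ v₄ hroots => ?_⟩
  obtain ⟨hb, hab, rfl, rfl, hδ, hE⟩ := Elliptic.quartic_eq_of_ordered_roots hγ hroots
  have hQ : ∀ s, Elliptic.quartic γ δ E s = γ * (s ^ 2 - a ^ 2) * (s ^ 2 - b ^ 2) := fun s => by
    rw [Elliptic.quartic, hE, hδ]; ring
  simp only [hQ]
  have hk1 := Elliptic.modulus_symm_sq_lt_one hb hab
  have hk0 := Elliptic.modulus_symm_pos hb hab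
  refine ⟨⟨?_, hk0, ?_⟩, Elliptic.snSolution_zero hb hab,
    fun t ht => Elliptic.snSolution_hasDerivAt hγ hb hab ht, fun x hx =>
    ⟨Elliptic.intervalIntegrable_one_div_sqrt hγ hb hab hx, fun t ht => ?_⟩,
    fun l r v v' hlr hv => Elliptic.exists_translate_of_first_integral hγ hb hab hlr hv⟩
  · rw [Elliptic.modulus_symm_sq hb hab, ← Elliptic.modulusSq_symm hb hab, Elliptic.modulusSq]
  · exact (sq_lt_one_iff₀ hk0.le).1 hk1
  · rw [Elliptic.integral_one_div_sqrt hγ hb hab hx]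
    constructor
    · rintro rfl
      exact ⟨fun τ hτ => Elliptic.den_pos_of_le_ellipticTime hγ hb hab hx hτ.1 hτ.2,
        (Elliptic.snSolution_ellipticTime hγ hb hab hx).symm⟩
    · rintro ⟨hden, rfl⟩
      exact Elliptic.ellipticTime_snSolution hγ hb hab ht hden
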